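/- **Setting.** Let $\mathbb T$ be the tree all of whose vertices have countably infinite valence. A *spheromorphism* of $\mathbb T$ is a permutation $g$ of $\mathrm{vert}(\mathbb T)$ that is an isomorphism of a forest obtained from $\mathbb T$ by removing finitely many edges onto another such forest. The *perfect forest* $\{S_\alpha\}$ of $g$ is the coarsest forest obtained by removing finitely many edges such that $g$ embeds each $S_\alpha$ in $\mathbb T$ as a tree; the removed edges are exactly the edges of $\mathbb T$ that $g$ does not send to edges. Products are compositions: $(g_1g_2)(v)=g_1(g_2(v))$. Let $I,J\subset\mathbb T$ be nonempty finite subtrees. An *$(I,J)$-bi-tree* is a finite graph $\Gamma$ with edges colored black, blue, red (each edge having one color), with embeddings $\iota:I\to\Gamma^{\rm black}_{\rm blue}$, $\jmath:J\to\Gamma^{\rm black}_{\rm red}$, such that the subgraphs $\Gamma^{\rm black}_{\rm blue}$ (all vertices, black and blue edges) and $\Gamma^{\rm black}_{\rm red}$ (all vertices, black and red edges) are trees, and every vertex of valence $1$ is an end of a black edge and lies in $\iota(I)\cup\jmath(J)$. Two of them are identified if there is a color-preserving isomorphism compatible with $\iota,\jmath$. *The $(I,J)$-bi-tree $\Gamma$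 of a spheromorphism $g$.* Call *blue* the edges of $\mathbb T$ outside $\bigcup S_\alpha$ and *red* the edges of $\mathbb T$ outside $\bigcup gS_\alpha$. Let $A$ be the minimal subtree of $\mathbb T$ containing $I$ and the blue edges, $B$ the minimal subtree containing $J$ and the red edges, and let $\Xi_\alpha\subset S_\alpha$ be the minimal subtree containing $S_\alpha\cap A$ and $g^{-1}(gS_\alpha\cap B)$. The vertices of $\Gamma$ are the vertices of the forest $\{\Xi_\alpha\}$; its black edges are the edges of the $\Xi_\alpha$; its blue edges are the blue edges of $\mathbb T$; and $v,w$ are joined by a red edge iff $[gv,gw]$ is a red edge of $\mathbb T$. Put $\iota(a)=a$, $\jmath(b)=g^{-1}b$. The inclusion and the map $v\mapsto gv$ embed $\Gamma^{\rm black}_{\rm blue}$ and $\Gamma^{\rm black}_{\rm red}$ in $\mathbb T$; denote their images by ${}^*\Gamma^{\rm black}_{\rm blue}$ and ${}^*\Gamma^{\rm black}_{\rm red}$. *Recoloring and pruning.* When two colored graphs $\Delta,\Gamma$ are drawn on the same vertices, double edges are treated as follows: (Δ-black, Γ-black) becomes black, (Δ-blue, Γ-black) becomes blue, (Δ-black,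 Γ-red) becomes red, (Δ-red, Γ-blue) becomes black, and (Δ-blue, Γ-red) edges are removed; other edges keep their color. Then one removes all vertices of valence $1$ that are ends of black edges and are not in the images of the two marked trees $J_3,J_1$, and repeats this until no such vertex is left. **Statement.** Let $J_1,J_2,J_3\subset\mathbb T$ be nonempty finite subtrees and $g_1,g_2$ spheromorphisms. Let $\Delta$ be the $(J_2,J_1)$-bi-tree of $g_1$, $\Gamma$ the $(J_3,J_2)$-bi-tree of $g_2$, and $\Xi$ the $(J_3,J_1)$-bi-tree of $g_1g_2$. 1. Let $\Theta$ be the graph on the vertices of ${}^*\Delta^{\rm black}_{\rm blue}\cup{}^*\Gamma^{\rm black}_{\rm red}\subset\mathbb T$ obtained as follows: take the colored edges of these two subtrees, add the red edges of $\Delta$ and the blue edges of $\Gamma$ (a vertex $v$ of $\Delta$ is drawn at $v$, a vertex $w$ of $\Gamma$ at $g_2w$), and recolor and prune. The tree $J_3$ is embedded by $a\mapsto g_2a$ and $J_1$ by $b\mapsto g_1^{-1}b$. Then $\Theta$ is a $(J_3,J_1)$-bi-tree. 2. $\Xi=\Theta$, up to equivalence. 3. Let $\Delta\diamond\Gamma$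 be the graph obtained by gluing the abstract graphs $\Delta$ and $\Gamma$ along the two images of $J_2$, recoloring and pruning, with $J_3$ embedded through $\Gamma$ and $J_1$ through $\Delta$. If ${}^*\Gamma^{\rm black}_{\rm red}\cap{}^*\Delta^{\rm black}_{\rm blue}=J_2$, then $\Xi=\Delta\diamond\Gamma$, up to equivalence. -/

import Mathlib

namespace Hier

universe u

variable {V : Type u}

/-- `T` is (a copy of) the homogeneous tree all of whose vertices have countably infinite valence. -/
structure IsOmegaTree (T : SimpleGraph V) : Prop where
  isTree : T.IsTree
  infinite : ∀ v, (T.neighborSet v).Infinite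
  countable : ∀ v, (T.neighborSet v).Countable

/-- A finite nonempty subtree of the tree `T`, given by its set of vertices (a subtree of a tree
is the full subgraph on its vertices; connectedness includes non-emptiness). -/
def IsFiniteSubtree (T : SimpleGraph V) (J : Set V) : Prop :=
  J.Finite ∧ (T.induce J).Connected

/-- The vertex set of the minimal subtree of `T` containing the vertices `A`. -/
def hull (T : SimpleGraph V) (A : Set V) : Set V :=
  ⋂₀ {S | A ⊆ S ∧ (T.induce S).Connected}

/-- A spheromorphism, regarded as a permutation of the vertices. A covering forest is what remains
of `T` after removing a finite set of edges; a spheromorphism is an isomorphism of one covering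
forest `T ∖ E` onto another one `T ∖ F`. -/
def IsSpheromorphism (T : SimpleGraph V) (g : Equiv.Perm V) : Prop :=
  ∃ E F : Set (Sym2 V), E ⊆ T.edgeSet ∧ F ⊆ T.edgeSet ∧ E.Finite ∧ F.Finite ∧
    ∀ v w, (T.deleteEdges E).Adj v w ↔ (T.deleteEdges F).Adj (g v) (g w)

/-- The covering forest `T ∖ E` is compatible with `g`: on each of its trees, `g` is an embedding
of trees into `T`. -/
def IsCompatible (T : SimpleGraph V) (g : Equiv.Perm V) (E : Set (Sym2 V)) : Prop :=
  E ⊆ T.edgeSet ∧ E.Finite ∧ ∀ v w, (T.deleteEdges E).Adj v w → T.Adj (g v) (g w)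

/-- The covering forest `T ∖ E` is perfect for `g`: it is compatible with `g`, and every compatible
covering forest is obtained from it by removing further edges. -/
def IsPerfect (T : SimpleGraph V) (g : Equiv.Perm V) (E : Set (Sym2 V)) : Prop :=
  IsCompatible T g E ∧ ∀ E', IsCompatible T g E' → E ⊆ E'

/-- The blue edges: the edges of `T` outside of the perfect covering forest `{S_α}` of `g`
(see `isPerfect_iff`). -/
def blueEdges (T : SimpleGraph V) (g : Equiv.Perm V) : Set (Sym2 V) :=
  {e | e ∈ T.edgeSet ∧ Sym2.map g e ∉ T.edgeSet}

/-- The red edges: the edges of `T` outside of the image `{g S_α}` of the perfect covering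
forest. -/
def redEdges (T : SimpleGraph V) (g : Equiv.Perm V) : Set (Sym2 V) :=
  T.edgeSet \ (Sym2.map g '' (T.edgeSet \ blueEdges T g))

/-- For a spheromorphism, removing the blue edges gives the unique perfect covering forest. -/
theorem isPerfect_iff (T : SimpleGraph V) (g : Equiv.Perm V) (hg : IsSpheromorphism T g)
    (E : Set (Sym2 V)) : IsPerfect T g E ↔ E = blueEdges T g := by
  have hmin : ∀ E', IsCompatible T g E' → blueEdges T g ⊆ E' := by
    intro E' h e he
    induction e with
    | _ v w =>
      by_contra hE
      refine he.2 ?_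
      have := h.2.2 v w (by
        rw [SimpleGraph.deleteEdges_adj]; exact ⟨he.1, hE⟩)
      simpa using this
  have hcomp : IsCompatible T g (blueEdges T g) := by
    refine ⟨fun e he => he.1, ?_, ?_⟩
    · obtain ⟨E, F, hE, hF, fE, fF, h⟩ := hg
      refine fE.subset (hmin E ⟨hE, fE, fun v w hvw => ?_⟩)
      exact (SimpleGraph.deleteEdges_adj.1 ((h v w).1 hvw)).1
    · intro v w hvw
      rw [SimpleGraph.deleteEdges_adj] at hvw
      by_contra hn
      exact hvw.2 ⟨hvw.1, by simpa using hn⟩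
  constructor
  · intro h
    exact Set.Subset.antisymm (h.2 _ hcomp) (hmin E h.1)
  · rintro rfl
    exact ⟨hcomp, hmin⟩

/-- The set of ends of a set of edges. -/
def ends (E : Set (Sym2 V)) : Set V := {v | ∃ e ∈ E, v ∈ e}

/-- The `I`-skeleton of `{S_α}`: the minimal subtree containing all blue edges and `I`. -/
def sourceSkeleton (T : SimpleGraph V) (I : Set V) (g : Equiv.Perm V) : Set V :=
  hull T (ends (blueEdges T g) ∪ I)

/-- The `J`-skeleton of `{g S_α}`: the minimal subtree containing all red edges and `J`. -/
def targetSkeleton (T : SimpleGraph V) (J : Set V) (g : Equiv.Perm V) : Set V :=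
  hull T (ends (redEdges T g) ∪ J)

/-- The tree `Ξ_c` in the component `S_c` of the perfect covering forest: the minimal subtree
containing `S_c ∩ Skel_I{S_α}` and `g⁻¹(g S_c ∩ Skel_J{g S_α})`. -/
def blackTree (T : SimpleGraph V) (I J : Set V) (g : Equiv.Perm V)
    (c : (T.deleteEdges (blueEdges T g)).ConnectedComponent) : Set V :=
  hull T ((c.supp ∩ sourceSkeleton T I g) ∪ (c.supp ∩ g ⁻¹' targetSkeleton T J g))

/-- The vertices of the forest `{Ξ_c}`. This is also the vertex set of the subtree
`*Γ_blue^black` of `T`, where `Γ` is the bi-tree of `g`. -/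
def starBlue (T : SimpleGraph V) (I J : Set V) (g : Equiv.Perm V) : Set V :=
  ⋃ c, blackTree T I J g c

/-- The vertex set of the subtree `*Γ_red^black` of `T`, where `Γ` is the bi-tree of `g`; the
embedding of `Γ_red^black` in `T` is `g` on vertices. -/
def starRed (T : SimpleGraph V) (I J : Set V) (g : Equiv.Perm V) : Set V :=
  g '' starBlue T I J g

theorem subset_hull (T : SimpleGraph V) (A : Set V) : A ⊆ hull T A :=
  Set.subset_sInter fun _ hS => hS.1

theorem source_mem_starBlue (T : SimpleGraph V) (I J : Set V) (g : Equiv.Perm V) {v : V}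
    (hv : v ∈ I) : v ∈ starBlue T I J g :=
  Set.mem_iUnion.2 ⟨(T.deleteEdges (blueEdges T g)).connectedComponentMk v,
    subset_hull T _ (Or.inl ⟨rfl, subset_hull T _ (Or.inr hv)⟩)⟩

theorem target_mem_starBlue (T : SimpleGraph V) (I J : Set V) (g : Equiv.Perm V) {v : V}
    (hv : v ∈ J) : g.symm v ∈ starBlue T I J g :=
  Set.mem_iUnion.2 ⟨(T.deleteEdges (blueEdges T g)).connectedComponentMk (g.symm v),
    subset_hull T _ (Or.inr ⟨rfl, by
      have h : v ∈ targetSkeleton T J g := subset_hull T _ (Or.inr hv)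
      simpa using h⟩)⟩

/-- A graph with edges colored black, blue and red, together with maps of (the vertex sets of)
`I` and `J` to its vertices. The three graphs on `X` are the sets of edges of each color. -/
structure MarkedGraph (I J : Set V) where
  X : Type u
  black : SimpleGraph X
  blue : SimpleGraph X
  red : SimpleGraph X
  ι : I → X
  j : J → X

namespace MarkedGraph

variable {I J K : Set V}

/-- The set of all edges. -/
def total (Γ : MarkedGraph I J) : SimpleGraph Γ.X := Γ.black ⊔ Γ.blue ⊔ Γ.red

/-- The vertices originated from `I` or `J`. -/
def marked (Γ : MarkedGraph I J) : Set Γ.X := Set.range Γ.ι ∪ Set.range Γ.j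

/-- `(Γ, ι, j)` is an `(I, J)`-bi-tree. -/
structure IsBiTree (T : SimpleGraph V) (Γ : MarkedGraph I J) : Prop where
  finite : Finite Γ.X
  black_blue : Disjoint Γ.black Γ.blue
  black_red : Disjoint Γ.black Γ.red
  blue_red : Disjoint Γ.blue Γ.red
  isTree_blue : (Γ.black ⊔ Γ.blue).IsTree
  isTree_red : (Γ.black ⊔ Γ.red).IsTree
  ι_injective : Function.Injective Γ.ι
  j_injective : Function.Injective Γ.j
  ι_adj : ∀ a b : I, T.Adj a b → (Γ.black ⊔ Γ.blue).Adj (Γ.ι a) (Γ.ι b)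
  j_adj : ∀ a b : J, T.Adj a b → (Γ.black ⊔ Γ.red).Adj (Γ.j a) (Γ.j b)
  terminal : ∀ v w, Γ.total.Adj v w → (∀ u, Γ.total.Adj v u → u = w) →
    Γ.black.Adj v w ∧ v ∈ Γ.marked

/-- Equivalence of `(I, J)`-bi-trees: a color-preserving isomorphism of graphs that respects the
embeddings of `I` and `J`. -/
def Equivalent (Γ Γ' : MarkedGraph I J) : Prop :=
  ∃ e : Γ.X ≃ Γ'.X,
    (∀ v w, Γ.black.Adj v w ↔ Γ'.black.Adj (e v) (e w)) ∧
    (∀ v w, Γ.blue.Adj v w ↔ Γ'.blue.Adj (e v) (e w)) ∧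
    (∀ v w, Γ.red.Adj v w ↔ Γ'.red.Adj (e v) (e w)) ∧
    (∀ a, e (Γ.ι a) = Γ'.ι a) ∧ (∀ b, e (Γ.j b) = Γ'.j b)

/-- Simultaneous removal, from the full subgraph on `S`, of all unmarked vertices of valence `1`
at which the only edge is black. -/
def pruneStep (Γ : MarkedGraph I J) (S : Set Γ.X) : Set Γ.X :=
  {v | v ∈ S ∧ ¬ (v ∉ Γ.marked ∧
    ∃ w ∈ S, Γ.black.Adj v w ∧ ∀ u ∈ S, Γ.total.Adj v u → u = w)}

/-- The vertices that survive all repetitions of the removal. -/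
def core (Γ : MarkedGraph I J) : Set Γ.X := ⋂ n : ℕ, Γ.pruneStep^[n] Set.univ

theorem marked_subset_core (Γ : MarkedGraph I J) : Γ.marked ⊆ Γ.core := by
  intro v hv
  refine Set.mem_iInter.2 fun n => ?_
  induction n with
  | zero => trivial
  | succ n ih =>
    rw [Function.iterate_succ_apply']
    exact ⟨ih, fun h => h.1 hv⟩

/-- The result of successively removing all terminal black edges (with their terminal vertices)
whose terminal vertex is not in the image of `I` or `J`. -/
def prune (Γ : MarkedGraph I J) : MarkedGraph I J where
  X := Γ.core
  black := Γ.black.induce Γ.core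
  blue := Γ.blue.induce Γ.core
  red := Γ.red.induce Γ.core
  ι a := ⟨Γ.ι a, Γ.marked_subset_core (Or.inl ⟨a, rfl⟩)⟩
  j b := ⟨Γ.j b, Γ.marked_subset_core (Or.inr ⟨b, rfl⟩)⟩

/-- Draw `Δ` and `Γ` on the same vertex set `X` by means of `p` and `q`, and then transform the
double edges to simple ones:
(Δ-black, Γ-black) to black, (Δ-blue, Γ-black) to blue, (Δ-black, Γ-red) to red,
(Δ-red, Γ-blue) to black; edges of the type (Δ-blue, Γ-red) are removed. Edges that come
from only one of `Δ`, `Γ` keep their color. -/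
def overlay (Δ : MarkedGraph J K) (Γ : MarkedGraph I J) {X : Type u}
    (p : Δ.X → X) (q : Γ.X → X) : MarkedGraph I K where
  X := X
  black := (Δ.black.map p \ Γ.red.map q) ⊔ (Γ.black.map q \ Δ.blue.map p) ⊔
    (Δ.red.map p ⊓ Γ.blue.map q)
  blue := (Δ.blue.map p \ Γ.red.map q) ⊔ (Γ.blue.map q \ Δ.red.map p)
  red := (Δ.red.map p \ Γ.blue.map q) ⊔ (Γ.red.map q \ Δ.blue.map p)
  ι a := q (Γ.ι a)
  j b := p (Δ.j b)

/-- Gluing of the vertices of `Δ` and `Γ` along the two images of `J`. -/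
def Glue (Δ : MarkedGraph J K) (Γ : MarkedGraph I J) : Type u :=
  Quot fun x y : Δ.X ⊕ Γ.X => ∃ a : J, x = Sum.inl (Δ.ι a) ∧ y = Sum.inr (Γ.j a)

/-- The product `Δ ⋄ Γ`: glue `Δ` and `Γ` along `J`, recolor the double edges, and remove
successively the terminal vertices outside of the images of `I` and `K`. -/
def diamond (Δ : MarkedGraph J K) (Γ : MarkedGraph I J) : MarkedGraph I K :=
  (overlay Δ Γ (X := Glue Δ Γ) (fun x => Quot.mk _ (Sum.inl x))
    (fun y => Quot.mk _ (Sum.inr y))).prune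

end MarkedGraph

/-- The `(I, J)`-bi-tree of `g`. Its vertices are the vertices of the forest `{Ξ_c}`. The black
edges are the edges of the trees `Ξ_c` (the edges of the perfect covering forest between
vertices of `{Ξ_c}`), the blue ones are the blue edges of `T`, and `v`, `w` are joined by a red edge
when `g v`, `g w` are the ends of a red edge of `T`. -/
def biTree (T : SimpleGraph V) (I J : Set V) (g : Equiv.Perm V) : MarkedGraph I J where
  X := starBlue T I J g
  black := (T.deleteEdges (blueEdges T g)).comap fun v : starBlue T I J g => (v : V)
  blue := (SimpleGraph.fromEdgeSet (blueEdges T g)).comap fun v : starBlue T I J g => (v : V)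
  red := (SimpleGraph.fromEdgeSet (redEdges T g)).comap fun v : starBlue T I J g => g v
  ι a := ⟨a, source_mem_starBlue T I J g a.2⟩
  j b := ⟨g.symm b, target_mem_starBlue T I J g b.2⟩

/-- The graph `Θ` for the product `g₁ g₂`. With `Δ` the `(J₂, J₁)`-bi-tree of `g₁` and `Γ` the
`(J₃, J₂)`-bi-tree of `g₂`, take the union of `*Δ_blue^black` and `*Γ_red^black` in `T`
(the other vertices and edges of `T` are grey and are discarded), add the red edges of `Δ` and the
blue edges of `Γ`, recolor, and remove successively the terminal black edges outside of the
images of `J₃` and `J₁`. -/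
def theta (T : SimpleGraph V) (J₁ J₂ J₃ : Set V) (g₁ g₂ : Equiv.Perm V) : MarkedGraph J₃ J₁ :=
  (MarkedGraph.overlay (biTree T J₂ J₁ g₁) (biTree T J₃ J₂ g₂)
    (X := ↥(starBlue T J₂ J₁ g₁ ∪ starRed T J₃ J₂ g₂))
    (fun v : starBlue T J₂ J₁ g₁ => ⟨v, Or.inl v.2⟩)
    (fun v : starBlue T J₃ J₂ g₂ => ⟨g₂ v, Or.inr ⟨v, v.2, rfl⟩⟩)).prune

end Hier

namespace Hier

universe u

variable {V : Type u}

/-! Everything can be drawn in the middle copy of the tree, where `g₂` arrives and `g₁` departs.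
There the vertex set carries three trees: `T` itself, the source tree `P = T.comap g₂.symm` and the
target tree `Q = T.comap g₁`. The bi-tree of a single `g` compares `T` with `T.comap g`: black edges
are the common ones, blue and red edges belong to only one of the two. By `starBlue_eq_hull`, its
vertices form the hull in `T` of the marked vertices and the ends of coloured edges.

Superposing the bi-trees of `g₁` and `g₂` compares `T` with `Q` and `P` with `T`. The recoloring
rules eliminate `T`: on the union `Y` of the two vertex sets, black becomes `P ∩ Q`, blue `P \ Q`
and red `Q \ P` (`thetaOverlay_adj`). The set `Y` is a subtree of `T`, and it contains all ends of
edges on which `T` differs from `P` or `Q`; by `PathConvex.of_diffEnds_subset` it is then a subtree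
of `P` and `Q` as well. So the superposition satisfies every bi-tree axiom except the one on leaves.

Pruning leaves exactly the hull, in the black-blue tree, of the marked vertices and the ends of
coloured edges (`core_eq_hull`). That gives the leaf condition. Moreover these vertices are the
`g₂`-image of those that define the bi-tree of `g₁ * g₂` (`image_pins_thetaOverlay`), so the two
hulls correspond under `g₂`. Finally, when the two subtrees of `T` meet only along `J₂`, abstract
gluing and union inside `T` agree. -/

/-! ### Path-convex sets and hulls; passing from one tree to another on the same vertices. -/

/-- `S` contains every path of `T` between two of its vertices. -/
def PathConvex (T : SimpleGraph V) (S : Set V) : Prop :=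
  ∀ ⦃a b⦄, a ∈ S → b ∈ S → ∀ p : T.Walk a b, p.IsPath → ∀ x ∈ p.support, x ∈ S

theorem PathConvex.connected {T : SimpleGraph V} (hT : T.Connected) {S : Set V}
    (hS : PathConvex T S) (hne : S.Nonempty) : (T.induce S).Connected := by
  classical
  obtain ⟨u, hu⟩ := hne
  refine T.induce_connected_of_patches u hu fun {v} hv => ?_
  obtain ⟨p, hp⟩ := (hT u v).exists_isPath
  exact ⟨{x | x ∈ p.support}, hS hu hv p hp, p.start_mem_support, p.end_mem_support,
    p.connected_induce_support _ _⟩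

/-- Paths in an acyclic graph are unique, so the path found inside `S` is the given one. Unlike
connectedness, convexity visibly survives intersections; this is how hulls are shown to be
connected. -/
theorem pathConvex_of_connected {T : SimpleGraph V} (hT : T.IsAcyclic) {S : Set V}
    (hS : (T.induce S).Connected) : PathConvex T S := by
  intro a b ha hb p hp x hx
  obtain ⟨q, hq⟩ := (hS ⟨a, ha⟩ ⟨b, hb⟩).exists_isPath
  let f : T.induce S ↪g T := SimpleGraph.Embedding.induce S
  have hf : (⟨p, hp⟩ : T.Path a b) = ⟨q.map f.toHom, hq.map f.injective⟩ :=
    (hT.subsingleton_path a b).elim _ _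
  have h : p.support = q.support.map f.toHom :=
    (congrArg (fun r : T.Path a b => r.1.support) hf).trans (q.support_map f.toHom)
  rw [h, List.mem_map] at hx
  obtain ⟨y, -, rfl⟩ := hx
  exact y.2

theorem pathConvex_hull {T : SimpleGraph V} (hT : T.IsAcyclic) (A : Set V) :
    PathConvex T (hull T A) := fun _ _ ha hb p hp x hx S hS =>
  pathConvex_of_connected hT hS.2 (ha S hS) (hb S hS) p hp x hx

theorem hull_connected {T : SimpleGraph V} (hT : T.IsTree) {A : Set V} (hA : A.Nonempty) :
    (T.induce (hull T A)).Connected :=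
  (pathConvex_hull hT.isAcyclic A).connected hT.connected (hA.mono (subset_hull T A))

theorem hull_subset {T : SimpleGraph V} {A S : Set V} (hA : A ⊆ S)
    (hS : (T.induce S).Connected) : hull T A ⊆ S := Set.sInter_subset_of_mem ⟨hA, hS⟩

theorem hull_mono (T : SimpleGraph V) {A B : Set V} (h : A ⊆ B) : hull T A ⊆ hull T B :=
  Set.sInter_subset_sInter fun _ hS => ⟨h.trans hS.1, hS.2⟩

theorem hull_finite {T : SimpleGraph V} (hT : T.Connected) {A : Set V} (hA : A.Finite)
    (hne : A.Nonempty) : (hull T A).Finite := by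
  obtain ⟨t, ht, hc⟩ := T.extend_finset_to_connected hT.preconnected
    (t := hA.toFinset) (by simpa using hne)
  exact t.finite_toSet.subset (hull_subset (fun a ha => ht (by simpa using ha)) hc)

/-- The ends of those edges of `P` that are not edges of `Q`. -/
def diffEnds (P Q : SimpleGraph V) : Set V := {v | ∃ w, P.Adj v w ∧ ¬ Q.Adj v w}

/-- A path of `Q` with ends in `S` is a sequence of edges of `Q` outside of `P`, all in `S`, and
of paths common to `P` and `Q` between vertices of `S`. -/
theorem PathConvex.of_diffEnds_subset {P Q : SimpleGraph V} {S : Set V} (hS : PathConvex P S)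
    (h : diffEnds Q P ⊆ S) : PathConvex Q S := by
  -- The induction carries the current run `q` of edges common to `P` and `Q`, started at some `s ∈
  -- S`; `p` is what remains of the `Q`-path. At an edge outside `P` the run ends in `S`, hence lies
  -- in `S` by convexity in `P`, and a trivial run restarts at the far end. The disjointness clause
  -- keeps the extended run a path.
  have key : ∀ (a b : V) (p : Q.Walk a b), b ∈ S → ∀ (s : V) (q : (P ⊓ Q).Walk s a), s ∈ S →
      q.IsPath → p.IsPath → (∀ x ∈ q.support, x ∈ p.support → x = a) →
      ∀ x, x ∈ q.support ∨ x ∈ p.support → x ∈ S := by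
    intro a b p hb
    induction p with
    | nil =>
      intro s q hs hq _ _ x hx
      have := hS hs hb (q.mapLe inf_le_left) (hq.mapLe _)
      rcases hx with hx | hx
      · exact this x (by simpa using hx)
      · rw [SimpleGraph.Walk.mem_support_nil_iff.1 hx]; exact hb
    | @cons a c b hac p ih =>
      intro s q hs hq hp hd x hx
      rw [SimpleGraph.Walk.cons_isPath_iff] at hp
      by_cases hP : P.Adj a c
      · refine ih hb s (q.concat ⟨hP, hac⟩) hs (hq.concat ?_ _) hp.1 ?_ x ?_
        · intro hc
          exact hac.ne (hd c hc (by simp)).symm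
        · intro x hx hx'
          rw [SimpleGraph.Walk.support_concat, List.mem_append] at hx
          rcases hx with hx | hx
          · exact absurd (hd x hx (by simp [hx']) ▸ hx') hp.2
          · simpa using hx
        · simp only [SimpleGraph.Walk.support_concat, List.mem_append]
          rcases hx with hx | hx
          · exact Or.inl (Or.inl hx)
          · rw [SimpleGraph.Walk.support_cons, List.mem_cons] at hx
            rcases hx with rfl | hx
            · exact Or.inl (Or.inl q.end_mem_support)
            · exact Or.inr hx
      · have ha : a ∈ S := h ⟨c, hac, hP⟩
        have hc : c ∈ S := h ⟨a, hac.symm, fun h' => hP h'.symm⟩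
        have h1 := hS hs ha (q.mapLe inf_le_left) (hq.mapLe _)
        have h2 := ih hb c .nil hc .nil hp.1 (by simp)
        rcases hx with hx | hx
        · exact h1 x (by simpa using hx)
        · rw [SimpleGraph.Walk.support_cons, List.mem_cons] at hx
          rcases hx with rfl | hx
          · exact ha
          · exact h2 x (Or.inr hx)
  intro a b ha hb p hp x hx
  exact key a b p hb a .nil ha .nil hp (by simp) x (Or.inr hx)

/-- The graph induced on `Subtype.val '' S` by `T` is the one induced on `S` by `T.induce Y`. -/
noncomputable def induceInduceIso (T : SimpleGraph V) {Y : Set V} (S : Set Y) :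
    (T.induce Y).induce S ≃g T.induce (Subtype.val '' S) where
  toEquiv := Equiv.Set.image _ S Subtype.val_injective
  map_rel_iff' := by intro a b; rfl

/-- The hull in `T` already lies in the subtree `Y`, so both hulls are minimal among the same
connected sets. This moves the hull left by pruning, computed on `thetaVerts`, to the ambient tree.
-/
theorem mem_hull_induce {T : SimpleGraph V} (hT : T.IsTree) {Y : Set V}
    (hY : (T.induce Y).Connected) {Z : Set Y} (hZ : Z.Nonempty) (y : Y) :
    y ∈ hull (T.induce Y) Z ↔ (y : V) ∈ hull T (Subtype.val '' Z) := by
  have hTY : (T.induce Y).IsTree := ⟨hY, hT.isAcyclic.induce Y⟩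
  constructor
  · intro hy
    have hsub : hull T (Subtype.val '' Z) ⊆ Y := hull_subset (by rintro _ ⟨z, -, rfl⟩; exact z.2) hY
    have himg : Subtype.val '' (Subtype.val ⁻¹' hull T (Subtype.val '' Z) : Set Y) =
        hull T (Subtype.val '' Z) := by
      rw [Subtype.image_preimage_coe, Set.inter_eq_right.2 hsub]
    refine hull_subset (S := Subtype.val ⁻¹' hull T (Subtype.val '' Z)) ?_ ?_ hy
    · exact fun z hz => subset_hull T _ ⟨z, hz, rfl⟩
    · rw [(induceInduceIso T _).connected_iff, himg]
      exact hull_connected hT (hZ.image _)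
  · intro hy
    have : hull T (Subtype.val '' Z) ⊆ Subtype.val '' hull (T.induce Y) Z := by
      refine hull_subset (Set.image_mono (subset_hull _ _)) ?_
      rw [← (induceInduceIso T _).connected_iff]
      exact hull_connected hTY hZ
    obtain ⟨z, hz, hzy⟩ := this hy
    exact Subtype.ext hzy ▸ hz

theorem hull_comap {W : Type*} (T : SimpleGraph W) (g : V ≃ W) (A : Set W) :
    hull (T.comap g) (g ⁻¹' A) = g ⁻¹' hull T A := by
  have hiso : ∀ S : Set W, ((T.comap g).induce (g ⁻¹' S)).Connected ↔ (T.induce S).Connected := by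
    intro S
    let e : (T.comap g).induce (g ⁻¹' S) ≃g T.induce S :=
      { toEquiv := g.subtypeEquiv fun _ => Iff.rfl
        map_rel_iff' := by intro a b; rfl }
    exact e.connected_iff
  ext v
  constructor
  · intro hv S hS
    exact hv (g ⁻¹' S) ⟨Set.preimage_mono hS.1, (hiso S).2 hS.2⟩
  · intro hv S hS
    have hS' : g ⁻¹' (g.symm ⁻¹' S) = S := by ext; simp
    have := hv (g.symm ⁻¹' S) ⟨fun a ha => hS.1 (by simpa using ha), by
      rw [← hiso, hS']; exact hS.2⟩
    simpa using this

theorem isTree_comap {W : Type*} {T : SimpleGraph W} (hT : T.IsTree) (g : V ≃ W) :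
    (T.comap g).IsTree :=
  let e : T.comap g ≃g T := { toEquiv := g, map_rel_iff' := by intro a b; rfl }
  e.isTree_iff.2 hT

theorem mem_and_mem_of_diffEnds_subset {P Q : SimpleGraph V} {S : Set V} (h : diffEnds P Q ⊆ S) {v w : V}
    (hP : P.Adj v w) (hQ : ¬ Q.Adj v w) : v ∈ S ∧ w ∈ S :=
  ⟨h ⟨w, hP, hQ⟩, h ⟨v, hP.symm, fun h' => hQ h'.symm⟩⟩

/-! ### Coloured edges as differences of `T` and `T.comap g`; the vertices of a bi-tree as a hull.
-/

theorem mem_blueEdges {T : SimpleGraph V} {g : Equiv.Perm V} {v w : V} :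
    s(v, w) ∈ blueEdges T g ↔ T.Adj v w ∧ ¬ T.Adj (g v) (g w) := by
  simp [blueEdges]

theorem mem_redEdges {T : SimpleGraph V} {g : Equiv.Perm V} {v w : V} :
    s(g v, g w) ∈ redEdges T g ↔ T.Adj (g v) (g w) ∧ ¬ T.Adj v w := by
  rw [redEdges, Set.mem_sdiff, SimpleGraph.mem_edgeSet, ← Sym2.map_mk,
    Set.InjOn.mem_image_iff (s := Set.univ) (Sym2.map.injective g.injective).injOn
      (Set.subset_univ _) (Set.mem_univ _), Set.mem_sdiff, mem_blueEdges, SimpleGraph.mem_edgeSet]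
  tauto

theorem deleteEdges_blueEdges_adj {T : SimpleGraph V} {g : Equiv.Perm V} {v w : V} :
    (T.deleteEdges (blueEdges T g)).Adj v w ↔ T.Adj v w ∧ T.Adj (g v) (g w) := by
  rw [SimpleGraph.deleteEdges_adj, mem_blueEdges]
  tauto

theorem ends_blueEdges (T : SimpleGraph V) (g : Equiv.Perm V) :
    ends (blueEdges T g) = diffEnds T (T.comap g) := by
  ext v
  constructor
  · rintro ⟨e, he, hv⟩
    obtain ⟨w, rfl⟩ := Sym2.mem_iff_exists.1 hv
    exact ⟨w, mem_blueEdges.1 he⟩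
  · rintro ⟨w, hw⟩
    exact ⟨s(v, w), mem_blueEdges.2 hw, Sym2.mem_mk_left v w⟩

theorem preimage_ends_redEdges (T : SimpleGraph V) (g : Equiv.Perm V) :
    g ⁻¹' ends (redEdges T g) = diffEnds (T.comap g) T := by
  ext v
  constructor
  · rintro ⟨e, he, hv⟩
    obtain ⟨w, rfl⟩ := Sym2.mem_iff_exists.1 hv
    obtain ⟨w, rfl⟩ := g.surjective w
    exact ⟨w, mem_redEdges.1 he⟩
  · rintro ⟨w, hw⟩
    exact ⟨s(g v, g w), mem_redEdges.2 hw, Sym2.mem_mk_left _ _⟩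

theorem finite_ends {E : Set (Sym2 V)} (hE : E.Finite) : (ends E).Finite := by
  have : ends E = ⋃ e ∈ E, {v | v ∈ e} := by ext; simp [ends]
  rw [this]
  refine hE.biUnion fun e _ => ?_
  induction e with
  | _ v w => exact (Set.toFinite {v, w}).subset fun x hx => by simpa using hx

theorem IsSpheromorphism.finite_diffEnds {T : SimpleGraph V} {g : Equiv.Perm V}
    (hg : IsSpheromorphism T g) :
    (diffEnds T (T.comap g)).Finite ∧ (diffEnds (T.comap g) T).Finite := by
  obtain ⟨E, F, -, -, fE, fF, h⟩ := hg
  constructor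
  · refine (finite_ends fE).subset ?_
    rintro v ⟨w, hw, hw'⟩
    refine ⟨s(v, w), ?_, Sym2.mem_mk_left _ _⟩
    by_contra hE
    exact hw' (SimpleGraph.deleteEdges_adj.1
      ((h v w).1 (SimpleGraph.deleteEdges_adj.2 ⟨hw, hE⟩))).1
  · refine ((finite_ends fF).preimage g.injective.injOn).subset ?_
    rintro v ⟨w, hw, hw'⟩
    refine ⟨s(g v, g w), ?_, Sym2.mem_mk_left _ _⟩
    by_contra hF
    exact hw' (SimpleGraph.deleteEdges_adj.1
      ((h v w).2 (SimpleGraph.deleteEdges_adj.2 ⟨hw, hF⟩))).1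

/-- The vertices that the bi-tree of `g` must contain: the marked ones and the ends of coloured
edges. -/
def pinned (T : SimpleGraph V) (I J : Set V) (g : Equiv.Perm V) : Set V :=
  diffEnds T (T.comap g) ∪ diffEnds (T.comap g) T ∪ I ∪ g ⁻¹' J

theorem pinned_finite {T : SimpleGraph V} {I J : Set V} {g : Equiv.Perm V}
    (hI : I.Finite) (hJ : J.Finite) (hg : IsSpheromorphism T g) : (pinned T I J g).Finite :=
  ((hg.finite_diffEnds.1.union hg.finite_diffEnds.2).union hI).union
    (hJ.preimage g.injective.injOn)

theorem preimage_targetSkeleton (T : SimpleGraph V) (J : Set V) (g : Equiv.Perm V) :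
    g ⁻¹' targetSkeleton T J g = hull (T.comap g) (diffEnds (T.comap g) T ∪ g ⁻¹' J) := by
  rw [targetSkeleton, ← hull_comap, Set.preimage_union, preimage_ends_redEdges]

/-- Walk from the component towards `I`: either no blue edge is met and the end of the walk serves,
or the near end of the first blue edge does. Hence every black tree is attached to the skeleton. -/
theorem exists_mem_supp_sourceSkeleton {T : SimpleGraph V} (hT : T.Connected) {I : Set V}
    (hI : I.Nonempty) (g : Equiv.Perm V)
    (c : (T.deleteEdges (blueEdges T g)).ConnectedComponent) :
    (c.supp ∩ sourceSkeleton T I g).Nonempty := by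
  have key : ∀ (v a : V) (_ : T.Walk v a), a ∈ sourceSkeleton T I g →
      ∃ b ∈ sourceSkeleton T I g, (T.deleteEdges (blueEdges T g)).Reachable v b := by
    intro v a p ha
    induction p with
    | nil => exact ⟨_, ha, .rfl⟩
    | @cons v w a h p ih =>
      by_cases hb : s(v, w) ∈ blueEdges T g
      · exact ⟨v, subset_hull T _ (Or.inl ⟨_, hb, Sym2.mem_mk_left v w⟩), .rfl⟩
      · obtain ⟨b, hbs, hr⟩ := ih ha
        exact ⟨b, hbs, (SimpleGraph.deleteEdges_adj.2 ⟨h, hb⟩).reachable.trans hr⟩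
  obtain ⟨v, rfl⟩ := c.exists_rep
  obtain ⟨a, ha⟩ := hI
  obtain ⟨p⟩ := hT v a
  obtain ⟨b, hb, hr⟩ := key v a p (subset_hull T _ (Or.inr ha))
  exact ⟨b, (SimpleGraph.ConnectedComponent.sound hr).symm, hb⟩

/-- The bi-tree of `g` spans the minimal subtree that contains all the vertices it must
contain. -/
theorem starBlue_eq_hull {T : SimpleGraph V} (hT : T.IsTree) {I J : Set V} (hI : I.Nonempty)
    (g : Equiv.Perm V) : starBlue T I J g = hull T (pinned T I J g) := by
  have hQ := isTree_comap hT g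
  have hp : (pinned T I J g).Nonempty := hI.mono fun x hx => Or.inl (Or.inr hx)
  have hsk : (ends (blueEdges T g) ∪ I).Nonempty := hI.mono Set.subset_union_right
  have hcov : ∀ v, v ∈ sourceSkeleton T I g ∨ g v ∈ targetSkeleton T J g →
      v ∈ blackTree T I J g ((T.deleteEdges (blueEdges T g)).connectedComponentMk v) := by
    rintro v (hv | hv)
    · exact subset_hull T _ (Or.inl ⟨rfl, hv⟩)
    · exact subset_hull T _ (Or.inr ⟨rfl, hv⟩)
  apply Set.Subset.antisymm
  · refine Set.iUnion_subset fun c => hull_subset (Set.union_subset ?_ ?_) (hull_connected hT hp)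
    · refine Set.inter_subset_right.trans (hull_mono T ?_)
      rw [ends_blueEdges]
      rintro x (hx | hx)
      exacts [Or.inl (Or.inl (Or.inl hx)), Or.inl (Or.inr hx)]
    · refine Set.inter_subset_right.trans ?_
      rw [preimage_targetSkeleton]
      have hsub : pinned T I J g ⊆ hull T (pinned T I J g) := subset_hull T _
      -- The pulled-back target skeleton is a hull in `T.comap g`, not in `T`. The hull of `pinned`
      -- is convex in both trees, since it contains the ends of the edges where they differ.
      refine hull_subset ?_ (((pathConvex_hull hT.isAcyclic _).of_diffEnds_subset
        fun x hx => hsub (Or.inl (Or.inl (Or.inr hx)))).connected hQ.connected (hp.mono hsub))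
      rintro x (hx | hx)
      exacts [hsub (Or.inl (Or.inl (Or.inr hx))), hsub (Or.inr hx)]
  · refine hull_subset ?_ ?_
    · have h1 : ∀ v, v ∈ sourceSkeleton T I g ∨ g v ∈ targetSkeleton T J g →
        v ∈ starBlue T I J g := fun v hv => Set.mem_iUnion.2 ⟨_, hcov v hv⟩
      rintro x (((hx | hx) | hx) | hx)
      · rw [← ends_blueEdges] at hx
        exact h1 x (Or.inl (subset_hull T _ (Or.inl hx)))
      · rw [← preimage_ends_redEdges] at hx
        exact h1 x (Or.inr (subset_hull T _ (Or.inl hx)))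
      · exact h1 x (Or.inl (subset_hull T _ (Or.inr hx)))
      · exact h1 x (Or.inr (subset_hull T _ (Or.inr hx)))
    · have hA : sourceSkeleton T I g ⊆ starBlue T I J g := fun v hv =>
        Set.mem_iUnion.2 ⟨_, hcov v (Or.inl hv)⟩
      obtain ⟨a, ha⟩ := hI
      have haA : a ∈ sourceSkeleton T I g := subset_hull T _ (Or.inr ha)
      refine T.induce_connected_of_patches a (hA haA) fun {v} hv => ?_
      obtain ⟨c, hc⟩ := Set.mem_iUnion.1 hv
      obtain ⟨b, hbc, hbA⟩ := exists_mem_supp_sourceSkeleton hT.connected ⟨a, ha⟩ g c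
      have hbt : b ∈ blackTree T I J g c := subset_hull T _ (Or.inl ⟨hbc, hbA⟩)
      exact ⟨sourceSkeleton T I g ∪ blackTree T I J g c,
        Set.union_subset hA (Set.subset_iUnion _ c), Or.inl haA, Or.inr hc,
        SimpleGraph.induce_union_connected (hull_connected hT hsk).preconnected
          (hull_connected hT ⟨b, Or.inl ⟨hbc, hbA⟩⟩).preconnected ⟨b, hbA, hbt⟩ _ _⟩

/-! ### Leaves and pruning. -/

theorem exists_two_adj_of_mem_path {X : Type*} {G : SimpleGraph X} {a b x : X} (p : G.Walk a b)
    (hp : p.IsPath) (hx : x ∈ p.support) (hxa : x ≠ a) (hxb : x ≠ b) :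
    ∃ u ∈ p.support, ∃ w ∈ p.support, u ≠ w ∧ G.Adj x u ∧ G.Adj x w := by
  induction p with
  | nil => exact absurd (SimpleGraph.Walk.mem_support_nil_iff.1 hx) hxa
  | @cons a c b h p ih =>
    rw [SimpleGraph.Walk.cons_isPath_iff] at hp
    rw [SimpleGraph.Walk.support_cons, List.mem_cons] at hx
    have hx := hx.resolve_left hxa
    by_cases hxc : x = c
    · subst hxc
      cases p with
      | nil => exact absurd rfl hxb
      | @cons _ d _ h' p =>
        have hd : d ∈ (SimpleGraph.Walk.cons h' p).support := by simp
        exact ⟨a, by simp, d, by simp, fun had => hp.2 (had ▸ hd), h.symm, h'⟩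
    · obtain ⟨u, hu, w, hw, h'⟩ := ih hp.1 hx hxc hxb
      exact ⟨u, by simp [hu], w, by simp [hw], h'⟩

/-- A finite path-convex set, of which a path-convex subset `H` is proper, has a vertex
outside of `H` with only one neighbour in the set. -/
theorem exists_leaf_outside {X : Type*} {G : SimpleGraph X} (hG : G.IsTree) {C H : Set X}
    (hC : PathConvex G C) (hCf : C.Finite) (hH : PathConvex G H) (hHC : H ⊆ C)
    (hne : H.Nonempty) (hCH : ¬ C ⊆ H) :
    ∃ v ∈ C, v ∉ H ∧ ∃ w ∈ C, G.Adj v w ∧ ∀ u ∈ C, G.Adj v u → u = w := by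
  obtain ⟨x, hx⟩ := hne
  -- The leaf is a vertex of `C \ H` farthest from a base point `x ∈ H`; its neighbour is the one
  -- towards `x`.
  obtain ⟨v, ⟨hvC, hvH⟩, hmax⟩ := (C \ H).exists_max_image (G.dist x) (hCf.subset Set.sdiff_subset)
    (Set.sdiff_nonempty.2 hCH)
  obtain ⟨p, hp, hpl⟩ := (hG.connected x v).exists_path_of_dist
  have hxv : x ≠ v := fun h => hvH (h ▸ hx)
  have hnil : ¬ p.Nil := SimpleGraph.Walk.not_nil_of_ne hxv
  refine ⟨v, hvC, hvH, p.penultimate, hC (hHC hx) hvC p hp _ (p.getVert_mem_support _),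
    (p.adj_penultimate hnil).symm, fun u huC huv => ?_⟩
  -- A neighbour nearer to `x` is the penultimate vertex, by uniqueness of paths. A farther one
  -- would lie in `H` by maximality, and convexity would then put `v` in `H`.
  rcases hG.dist_eq_dist_add_one_of_adj x huv with h | h
  · obtain ⟨q, hq, hql⟩ := (hG.connected x u).exists_path_of_dist
    have hqp : (q.concat huv.symm).IsPath :=
      SimpleGraph.Walk.isPath_of_length_eq_dist _ (by
        rw [SimpleGraph.Walk.length_concat, hql, h])
    have := (hG.existsUnique_path x v).unique hp hqp
    rw [this, SimpleGraph.Walk.penultimate_concat]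
  · have hpp : (p.concat huv).IsPath :=
      SimpleGraph.Walk.isPath_of_length_eq_dist _ (by
        rw [SimpleGraph.Walk.length_concat, hpl, h])
    have huH : u ∈ H := by
      by_contra hu
      have := hmax u ⟨huC, hu⟩
      omega
    refine absurd (hH hx huH _ hpp v ?_) hvH
    rw [SimpleGraph.Walk.support_concat]
    simp

namespace MarkedGraph

variable {I J : Set V}

/-- All the conditions on a bi-tree, except for the one on the vertices of valence `1`. -/
structure IsUnprunedBiTree (T : SimpleGraph V) (Γ : MarkedGraph I J) : Prop where
  finite : Finite Γ.X
  black_blue : Disjoint Γ.black Γ.blue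
  black_red : Disjoint Γ.black Γ.red
  blue_red : Disjoint Γ.blue Γ.red
  isTree_blue : (Γ.black ⊔ Γ.blue).IsTree
  isTree_red : (Γ.black ⊔ Γ.red).IsTree
  ι_injective : Function.Injective Γ.ι
  j_injective : Function.Injective Γ.j
  ι_adj : ∀ a b : I, T.Adj a b → (Γ.black ⊔ Γ.blue).Adj (Γ.ι a) (Γ.ι b)
  j_adj : ∀ a b : J, T.Adj a b → (Γ.black ⊔ Γ.red).Adj (Γ.j a) (Γ.j b)

/-- The vertices that are marked or ends of coloured edges. -/
def pins (Γ : MarkedGraph I J) : Set Γ.X :=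
  Γ.marked ∪ {v | ∃ w, Γ.blue.Adj v w ∨ Γ.red.Adj v w}

variable {T : SimpleGraph V} {Γ : MarkedGraph I J}

theorem pruneStep_subset (S : Set Γ.X) : Γ.pruneStep S ⊆ S := fun _ h => h.1

theorem black_of_total_of_not_mem_pins {v w : Γ.X} (hv : v ∉ Γ.pins) (h : Γ.total.Adj v w) :
    Γ.black.Adj v w := by
  rcases h with (h | h) | h
  · exact h
  · exact absurd (Or.inr ⟨w, Or.inl h⟩) hv
  · exact absurd (Or.inr ⟨w, Or.inr h⟩) hv

theorem not_adj_both {X : Type*} {G H : SimpleGraph X} (h : Disjoint G H) {v w : X}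
    (hG : G.Adj v w) (hH : H.Adj v w) : False :=
  (disjoint_iff_inf_le.1 h : G ⊓ H ≤ ⊥) ⟨hG, hH⟩

/-- If an end of a coloured edge had a single neighbour, joined to it by a black edge, that same
edge would carry two colours. -/
theorem IsUnprunedBiTree.pins_subset_pruneStep (hΓ : Γ.IsUnprunedBiTree T) {S : Set Γ.X}
    (hS : Γ.pins ⊆ S) : Γ.pins ⊆ Γ.pruneStep S := by
  intro v hv
  refine ⟨hS hv, ?_⟩
  rintro ⟨hm, w, -, hvw, huniq⟩
  obtain ⟨u, hu⟩ := hv.resolve_left hm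
  have huS : u ∈ S := hS (Or.inr ⟨v, hu.imp SimpleGraph.Adj.symm SimpleGraph.Adj.symm⟩)
  rcases hu with hu | hu
  · exact not_adj_both hΓ.black_blue hvw (huniq u huS (Or.inl (Or.inr hu)) ▸ hu)
  · exact not_adj_both hΓ.black_red hvw (huniq u huS (Or.inr hu) ▸ hu)

/-- An interior vertex of a path has two neighbours on it, so pruning never cuts a path between
survivors. -/
theorem pathConvex_pruneStep {S : Set Γ.X} (hS : PathConvex (Γ.black ⊔ Γ.blue) S) :
    PathConvex (Γ.black ⊔ Γ.blue) (Γ.pruneStep S) := by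
  intro a b ha hb p hp x hx
  by_cases hxa : x = a
  · exact hxa ▸ ha
  by_cases hxb : x = b
  · exact hxb ▸ hb
  have hmem := hS ha.1 hb.1 p hp
  refine ⟨hmem x hx, ?_⟩
  rintro ⟨-, y, -, -, huniq⟩
  obtain ⟨u, hu, w, hw, hne, hxu, hxw⟩ := exists_two_adj_of_mem_path p hp hx hxa hxb
  exact hne ((huniq u (hmem u hu) (Or.inl hxu)).trans (huniq w (hmem w hw) (Or.inl hxw)).symm)

/-- Finiteness makes the decreasing sequence of prunings stationary, so the core is one of its terms
and is fixed by a further pruning. -/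
theorem IsUnprunedBiTree.core_spec (hΓ : Γ.IsUnprunedBiTree T) :
    Γ.pins ⊆ Γ.core ∧ PathConvex (Γ.black ⊔ Γ.blue) Γ.core ∧ Γ.core ⊆ Γ.pruneStep Γ.core := by
  have hn : ∀ n : ℕ, Γ.pins ⊆ Γ.pruneStep^[n] Set.univ ∧
      PathConvex (Γ.black ⊔ Γ.blue) (Γ.pruneStep^[n] Set.univ) := by
    intro n
    induction n with
    | zero => exact ⟨Set.subset_univ _, fun _ _ _ _ _ _ _ _ => trivial⟩
    | succ n ih =>
      rw [Function.iterate_succ_apply']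
      exact ⟨hΓ.pins_subset_pruneStep ih.1, pathConvex_pruneStep ih.2⟩
  refine ⟨Set.subset_iInter fun n => (hn n).1, ?_, ?_⟩
  · intro a b ha hb p hp x hx
    exact Set.mem_iInter.2 fun n =>
      (hn n).2 (Set.mem_iInter.1 ha n) (Set.mem_iInter.1 hb n) p hp x hx
  · have := hΓ.finite
    have hanti : Antitone fun n : ℕ => Γ.pruneStep^[n] Set.univ := by
      refine antitone_nat_of_succ_le fun n => ?_
      rw [Function.iterate_succ_apply']
      exact pruneStep_subset _
    obtain ⟨n, hstab⟩ := WellFoundedLT.antitone_chain_condition hanti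
    have hcore : Γ.core = Γ.pruneStep^[n] Set.univ := by
      refine (Set.iInter_subset _ n).antisymm (Set.subset_iInter fun m => ?_)
      rcases le_total n m with h | h
      · exact (hstab m h).subset
      · exact hanti h
    have h1 := hstab (n + 1) n.le_succ
    simp only [Function.iterate_succ_apply'] at h1
    rw [hcore, ← h1]

/-- Were the core larger than the hull, it would have a leaf outside the hull. Such a leaf is
unmarked and meets only black edges, so one more pruning would remove it. -/
theorem IsUnprunedBiTree.core_eq_hull (hΓ : Γ.IsUnprunedBiTree T) (hne : Γ.pins.Nonempty) :
    Γ.core = hull (Γ.black ⊔ Γ.blue) Γ.pins := by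
  have := hΓ.finite
  obtain ⟨hpins, hconv, hfix⟩ := hΓ.core_spec
  have hsub : hull (Γ.black ⊔ Γ.blue) Γ.pins ⊆ Γ.core :=
    hull_subset hpins (hconv.connected hΓ.isTree_blue.connected (hne.mono hpins))
  refine Set.Subset.antisymm ?_ hsub
  by_contra hCH
  obtain ⟨v, hv, hvH, w, hw, hvw, huniq⟩ := exists_leaf_outside hΓ.isTree_blue hconv
    (Set.toFinite _) (pathConvex_hull hΓ.isTree_blue.isAcyclic _) hsub
    (hne.mono (subset_hull _ _)) hCH
  have hvp : v ∉ Γ.pins := fun h => hvH (subset_hull _ _ h)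
  refine (hfix hv).2 ⟨fun h => hvp (Or.inl h), w, hw,
    black_of_total_of_not_mem_pins hvp (Or.inl hvw), fun u hu hvu => ?_⟩
  exact huniq u hu (Or.inl (black_of_total_of_not_mem_pins hvp hvu))

theorem exists_adj_of_connected {X : Type*} {G : SimpleGraph X} (hG : G.Connected) {v w : X}
    (h : v ≠ w) : ∃ u, G.Adj v u := by
  obtain ⟨p⟩ := hG v w
  cases p with
  | nil => exact absurd rfl h
  | cons h' _ => exact ⟨_, h'⟩

theorem IsUnprunedBiTree.isBiTree_prune (hΓ : Γ.IsUnprunedBiTree T) (hne : Γ.pins.Nonempty) :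
    Γ.prune.IsBiTree T := by
  have := hΓ.finite
  obtain ⟨hpins, hconv, hfix⟩ := hΓ.core_spec
  have hconv' : PathConvex (Γ.black ⊔ Γ.red) Γ.core := by
    refine hconv.of_diffEnds_subset ?_
    rintro v ⟨w, h | h, h'⟩
    · exact absurd (Or.inl h) h'
    · exact hpins (Or.inr ⟨w, Or.inr h⟩)
  have hne' := hne.mono hpins
  have tb : (Γ.prune.black ⊔ Γ.prune.blue).IsTree :=
    ⟨hconv.connected hΓ.isTree_blue.connected hne', hΓ.isTree_blue.isAcyclic.induce _⟩
  have tr : (Γ.prune.black ⊔ Γ.prune.red).IsTree :=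
    ⟨hconv'.connected hΓ.isTree_red.connected hne', hΓ.isTree_red.isAcyclic.induce _⟩
  have hd : ∀ {G H : SimpleGraph Γ.X}, Disjoint G H →
      Disjoint (G.induce Γ.core) (H.induce Γ.core) := fun h =>
    disjoint_iff_inf_le.2 fun v w hvw => (not_adj_both h hvw.1 hvw.2).elim
  refine ⟨inferInstanceAs (Finite Γ.core), hd hΓ.black_blue, hd hΓ.black_red, hd hΓ.blue_red,
    tb, tr, fun a b h => hΓ.ι_injective (congrArg Subtype.val h),
    fun a b h => hΓ.j_injective (congrArg Subtype.val h), hΓ.ι_adj, hΓ.j_adj, ?_⟩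
  intro v w hvw huniq
  -- A leaf whose only edge were blue would be isolated in the black-red tree, and symmetrically for
  -- red.
  have hblack : Γ.prune.black.Adj v w := by
    rcases hvw with (h | h) | h
    · exact h
    · obtain ⟨u, hu⟩ := exists_adj_of_connected tr.connected h.ne
      have huw := huniq u (hu.imp (fun h => Or.inl h) id)
      rcases huw ▸ hu with hu | hu
      · exact hu
      · exact (not_adj_both (hd hΓ.blue_red) h hu).elim
    · obtain ⟨u, hu⟩ := exists_adj_of_connected tb.connected h.ne
      have huw := huniq u (Or.inl hu)
      rcases huw ▸ hu with hu | hu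
      · exact hu
      · exact (not_adj_both (hd hΓ.blue_red) hu h).elim
  refine ⟨hblack, ?_⟩
  by_contra hm
  refine (hfix v.2).2 ⟨fun h => hm ?_, w.1, w.2, hblack, fun u hu hvu =>
    congrArg Subtype.val (huniq ⟨u, hu⟩ hvu)⟩
  rcases h with ⟨a, ha⟩ | ⟨a, ha⟩
  · exact Or.inl ⟨a, Subtype.ext ha⟩
  · exact Or.inr ⟨a, Subtype.ext ha⟩

end MarkedGraph

/-! ### The superposition of two bi-trees inside the middle tree. -/

theorem biTree_black_adj {T : SimpleGraph V} {I J : Set V} {g : Equiv.Perm V}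
    {v w : starBlue T I J g} :
    (biTree T I J g).black.Adj v w ↔ T.Adj v w ∧ T.Adj (g v) (g w) :=
  deleteEdges_blueEdges_adj

theorem biTree_blue_adj {T : SimpleGraph V} {I J : Set V} {g : Equiv.Perm V}
    {v w : starBlue T I J g} :
    (biTree T I J g).blue.Adj v w ↔ T.Adj v w ∧ ¬ T.Adj (g v) (g w) := by
  change (SimpleGraph.fromEdgeSet (blueEdges T g)).Adj (v : V) w ↔ _
  rw [SimpleGraph.fromEdgeSet_adj, mem_blueEdges]
  exact and_iff_left_of_imp fun h => h.1.ne

theorem biTree_red_adj {T : SimpleGraph V} {I J : Set V} {g : Equiv.Perm V}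
    {v w : starBlue T I J g} :
    (biTree T I J g).red.Adj v w ↔ T.Adj (g v) (g w) ∧ ¬ T.Adj v w := by
  change (SimpleGraph.fromEdgeSet (redEdges T g)).Adj (g v) (g w) ↔ _
  rw [SimpleGraph.fromEdgeSet_adj, mem_redEdges]
  exact and_iff_left_of_imp fun h => h.1.ne

/-- The union of two subtrees of a tree that have a common vertex has no edges other than those
of the two subtrees. -/
theorem adj_mem_or_mem {T : SimpleGraph V} (hT : T.Connected) {D G : Set V}
    (hD : PathConvex T D) (hG : PathConvex T G) (hDG : (D ∩ G).Nonempty) {v w : V}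
    (hvw : T.Adj v w) (hv : v ∈ D ∪ G) (hw : w ∈ D ∪ G) :
    (v ∈ D ∧ w ∈ D) ∨ (v ∈ G ∧ w ∈ G) := by
  obtain ⟨z, hzD, hzG⟩ := hDG
  have key : ∀ {A B : Set V}, PathConvex T A → PathConvex T B → z ∈ A → z ∈ B →
      ∀ {v w}, T.Adj v w → v ∈ A → w ∈ B → w ∈ A ∨ v ∈ B := by
    intro A B hA hB hzA hzB v w hvw hv hw
    -- Either the path from the common vertex `z` to `v` passes through `w`, or prolonging it by the
    -- edge gives a path from `z` to `w` through `v`.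
    obtain ⟨p, hp⟩ := (hT z v).exists_isPath
    by_cases hwp : w ∈ p.support
    · exact Or.inl (hA hzA hv p hp w hwp)
    · exact Or.inr (hB hzB hw _ (hp.concat hwp hvw) v (by
        rw [SimpleGraph.Walk.support_concat]; simp))
  rcases hv with hv | hv <;> rcases hw with hw | hw
  · exact Or.inl ⟨hv, hw⟩
  · rcases key hD hG hzD hzG hvw hv hw with h | h
    exacts [Or.inl ⟨hv, h⟩, Or.inr ⟨h, hw⟩]
  · rcases key hG hD hzG hzD hvw hv hw with h | h
    exacts [Or.inr ⟨hv, h⟩, Or.inl ⟨h, hw⟩]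
  · exact Or.inr ⟨hv, hw⟩

theorem starRed_eq_hull {T : SimpleGraph V} (hT : T.IsTree) {I J : Set V} (hI : I.Nonempty)
    (g : Equiv.Perm V) :
    starRed T I J g = hull (T.comap g.symm) (g.symm ⁻¹' pinned T I J g) := by
  rw [starRed, starBlue_eq_hull hT hI, Equiv.image_eq_preimage_symm, hull_comap]

theorem symm_preimage_diffEnds_left (T : SimpleGraph V) (g : Equiv.Perm V) :
    g.symm ⁻¹' diffEnds T (T.comap g) = diffEnds (T.comap g.symm) T := by
  ext v
  constructor
  · rintro ⟨w, hw⟩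
    exact ⟨g w, by simpa using hw⟩
  · rintro ⟨w, hw⟩
    exact ⟨g.symm w, by simpa using hw⟩

theorem symm_preimage_diffEnds_right (T : SimpleGraph V) (g : Equiv.Perm V) :
    g.symm ⁻¹' diffEnds (T.comap g) T = diffEnds T (T.comap g.symm) := by
  ext v
  constructor
  · rintro ⟨w, hw⟩
    exact ⟨g w, by simpa using hw⟩
  · rintro ⟨w, hw⟩
    exact ⟨g.symm w, by simpa using hw⟩

section Product

variable {T : SimpleGraph V} {J₁ J₂ J₃ : Set V} {g₁ g₂ : Equiv.Perm V}

theorem diffEnds_subset_starBlue (hT : T.IsTree) {I J : Set V} (hI : I.Nonempty)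
    (g : Equiv.Perm V) : diffEnds T (T.comap g) ⊆ starBlue T I J g ∧
      diffEnds (T.comap g) T ⊆ starBlue T I J g := by
  rw [starBlue_eq_hull hT hI]
  have h := subset_hull T (pinned T I J g)
  exact ⟨fun x hx => h (Or.inl (Or.inl (Or.inl hx))), fun x hx => h (Or.inl (Or.inl (Or.inr hx)))⟩

theorem diffEnds_subset_starRed (hT : T.IsTree) {I J : Set V} (hI : I.Nonempty)
    (g : Equiv.Perm V) : diffEnds (T.comap g.symm) T ⊆ starRed T I J g ∧
      diffEnds T (T.comap g.symm) ⊆ starRed T I J g := by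
  obtain ⟨h1, h2⟩ := diffEnds_subset_starBlue hT (J := J) hI g
  rw [starRed, Equiv.image_eq_preimage_symm, ← symm_preimage_diffEnds_left, ← symm_preimage_diffEnds_right]
  exact ⟨Set.preimage_mono h1, Set.preimage_mono h2⟩

theorem pathConvex_starBlue (hT : T.IsTree) {I J : Set V} (hI : I.Nonempty)
    (g : Equiv.Perm V) : PathConvex T (starBlue T I J g) := by
  rw [starBlue_eq_hull hT hI]
  exact pathConvex_hull hT.isAcyclic _

/-- The set is a hull in `T.comap g.symm`; convexity passes to `T` because it contains the ends of
the edges that only `T` has. -/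
theorem pathConvex_starRed (hT : T.IsTree) {I J : Set V} (hI : I.Nonempty)
    (g : Equiv.Perm V) : PathConvex T (starRed T I J g) := by
  refine PathConvex.of_diffEnds_subset (P := T.comap g.symm) ?_ (diffEnds_subset_starRed hT hI g).2
  rw [starRed_eq_hull hT hI]
  exact pathConvex_hull (isTree_comap hT g.symm).isAcyclic _

theorem subset_starBlue_inter_starRed :
    J₂ ⊆ starBlue T J₂ J₁ g₁ ∩ starRed T J₃ J₂ g₂ := fun x hx =>
  ⟨source_mem_starBlue T J₂ J₁ g₁ hx,
    ⟨g₂.symm x, target_mem_starBlue T J₃ J₂ g₂ hx, g₂.apply_symm_apply x⟩⟩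

variable (T J₁ J₂ J₃ g₁ g₂) in
/-- The vertices of `T` on which `theta` is drawn. -/
def thetaVerts : Set V := starBlue T J₂ J₁ g₁ ∪ starRed T J₃ J₂ g₂

theorem thetaVerts_pathConvex (hT : T.IsTree) (h₂ : J₂.Nonempty) (h₃ : J₃.Nonempty) :
    PathConvex T (thetaVerts T J₁ J₂ J₃ g₁ g₂) := by
  have hne := h₂.mono (subset_starBlue_inter_starRed (T := T) (J₁ := J₁) (J₃ := J₃) (g₁ := g₁)
    (g₂ := g₂))
  refine pathConvex_of_connected hT.isAcyclic (SimpleGraph.induce_union_connected ?_ ?_ hne)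
  · exact ((pathConvex_starBlue hT h₂ g₁).connected hT.connected
      (hne.mono Set.inter_subset_left)).preconnected
  · exact ((pathConvex_starRed hT h₃ g₂).connected hT.connected
      (hne.mono Set.inter_subset_right)).preconnected

theorem thetaVerts_connected_source (hT : T.IsTree) (h₂ : J₂.Nonempty) (h₃ : J₃.Nonempty) :
    ((T.comap g₂.symm).induce (thetaVerts T J₁ J₂ J₃ g₁ g₂)).Connected :=
  ((thetaVerts_pathConvex hT h₂ h₃).of_diffEnds_subset
    ((diffEnds_subset_starRed hT h₃ g₂).1.trans Set.subset_union_right)).connected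
    (isTree_comap hT g₂.symm).connected
    (h₂.mono fun _ hx => Or.inl (subset_starBlue_inter_starRed (J₃ := J₃) (g₂ := g₂) hx).1)

theorem thetaVerts_connected_target (hT : T.IsTree) (h₂ : J₂.Nonempty) (h₃ : J₃.Nonempty) :
    ((T.comap g₁).induce (thetaVerts T J₁ J₂ J₃ g₁ g₂)).Connected :=
  ((thetaVerts_pathConvex hT h₂ h₃).of_diffEnds_subset
    ((diffEnds_subset_starBlue hT h₂ g₁).2.trans Set.subset_union_left)).connected
    (isTree_comap hT g₁).connected
    (h₂.mono fun _ hx => Or.inl (subset_starBlue_inter_starRed (J₃ := J₃) (g₂ := g₂) hx).1)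

variable (T J₁ J₂ J₃ g₁ g₂) in
/-- The graph from which `theta` is obtained by pruning. -/
def thetaOverlay : MarkedGraph J₃ J₁ :=
  MarkedGraph.overlay (biTree T J₂ J₁ g₁) (biTree T J₃ J₂ g₂)
    (X := ↥(thetaVerts T J₁ J₂ J₃ g₁ g₂))
    (fun v : starBlue T J₂ J₁ g₁ => ⟨v, Or.inl v.2⟩)
    (fun v : starBlue T J₃ J₂ g₂ => ⟨g₂ v, Or.inr ⟨v, v.2, rfl⟩⟩)

/-- The edges of a graph on `starBlue`, drawn in a larger set of vertices. -/
theorem map_inclusion_adj {D Y : Set V} {H : SimpleGraph D} {R : V → V → Prop}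
    (hR : ∀ v w : D, H.Adj v w ↔ R v w) (f : D → Y) (hf : ∀ v, (f v : V) = v) (x y : Y) :
    (H.map f).Adj x y ↔ (x : V) ∈ D ∧ (y : V) ∈ D ∧ R x y := by
  rw [SimpleGraph.map_adj']
  constructor
  · rintro ⟨-, v, w, h, rfl, rfl⟩
    rw [hf, hf]
    exact ⟨v.2, w.2, (hR v w).1 h⟩
  · rintro ⟨hx, hy, h⟩
    have h' := (hR ⟨x, hx⟩ ⟨y, hy⟩).2 h
    refine ⟨fun hxy => h'.ne (Subtype.ext (congrArg (fun z : Y => (z : V)) hxy)), ⟨x, hx⟩, ⟨y, hy⟩, h',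
      Subtype.ext (hf _), Subtype.ext (hf _)⟩

theorem map_perm_adj {D Y : Set V} {g : Equiv.Perm V} {H : SimpleGraph D} {R : V → V → Prop}
    (hR : ∀ v w : D, H.Adj v w ↔ R (g v) (g w)) (f : D → Y) (hf : ∀ v, (f v : V) = g v)
    (x y : Y) : (H.map f).Adj x y ↔ (x : V) ∈ g '' D ∧ (y : V) ∈ g '' D ∧ R x y := by
  rw [SimpleGraph.map_adj']
  constructor
  · rintro ⟨-, v, w, h, rfl, rfl⟩
    rw [hf, hf]
    exact ⟨⟨v, v.2, rfl⟩, ⟨w, w.2, rfl⟩, (hR v w).1 h⟩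
  · rintro ⟨⟨v, hv, hvx⟩, ⟨w, hw, hwy⟩, h⟩
    rw [← hvx, ← hwy] at h
    have h' := (hR ⟨v, hv⟩ ⟨w, hw⟩).2 h
    refine ⟨fun hxy => h'.ne (Subtype.ext (g.injective ?_)), ⟨v, hv⟩, ⟨w, hw⟩, h',
      Subtype.ext ((hf _).trans hvx), Subtype.ext ((hf _).trans hwy)⟩
    rw [hvx, hwy, hxy]

/-- The recoloring table is composition of differences: with `P`, `T`, `Q` the source, middle and
target trees, the comparisons of `P` with `T` and of `T` with `Q` yield that of `P` with `Q`. For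
instance (Δ-red, Γ-blue) means an edge of `P` and `Q` but not of `T`, hence black, and (Δ-blue,
Γ-red) an edge of `T` alone, hence none. -/
theorem thetaOverlay_adj (hT : T.IsTree) (h₂ : J₂.Nonempty) (h₃ : J₃.Nonempty)
    (x y : thetaVerts T J₁ J₂ J₃ g₁ g₂) :
    ((thetaOverlay T J₁ J₂ J₃ g₁ g₂).black.Adj x y ↔
      (T.comap g₂.symm).Adj x y ∧ (T.comap g₁).Adj x y) ∧
    ((thetaOverlay T J₁ J₂ J₃ g₁ g₂).blue.Adj x y ↔
      (T.comap g₂.symm).Adj x y ∧ ¬ (T.comap g₁).Adj x y) ∧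
    ((thetaOverlay T J₁ J₂ J₃ g₁ g₂).red.Adj x y ↔
      (T.comap g₁).Adj x y ∧ ¬ (T.comap g₂.symm).Adj x y) := by
  have e : ∀ v w : V, (T.comap g₂.symm).Adj (g₂ v) (g₂ w) ↔ T.Adj v w := by simp
  let p : starBlue T J₂ J₁ g₁ → thetaVerts T J₁ J₂ J₃ g₁ g₂ := fun v => ⟨v, Or.inl v.2⟩
  let q : starBlue T J₃ J₂ g₂ → thetaVerts T J₁ J₂ J₃ g₁ g₂ :=
    fun v => ⟨g₂ v, Or.inr ⟨v, v.2, rfl⟩⟩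
  have db := map_inclusion_adj
    (R := fun v w => T.Adj v w ∧ (T.comap g₁).Adj v w)
    (fun v w => biTree_black_adj (T := T) (I := J₂) (J := J₁)) p (fun _ => rfl) x y
  have dl := map_inclusion_adj
    (R := fun v w => T.Adj v w ∧ ¬ (T.comap g₁).Adj v w)
    (fun v w => biTree_blue_adj (T := T) (I := J₂) (J := J₁)) p (fun _ => rfl) x y
  have dr := map_inclusion_adj
    (R := fun v w => (T.comap g₁).Adj v w ∧ ¬ T.Adj v w)
    (fun v w => biTree_red_adj (T := T) (I := J₂) (J := J₁)) p (fun _ => rfl) x y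
  have gb := map_perm_adj (R := fun v w => (T.comap g₂.symm).Adj v w ∧ T.Adj v w)
    (fun v w => (biTree_black_adj (T := T) (I := J₃) (J := J₂) (g := g₂)).trans
      (and_congr_left' (e v w).symm)) q (fun _ => rfl) x y
  have gl := map_perm_adj (R := fun v w => (T.comap g₂.symm).Adj v w ∧ ¬ T.Adj v w)
    (fun v w => (biTree_blue_adj (T := T) (I := J₃) (J := J₂) (g := g₂)).trans
      (and_congr_left' (e v w).symm)) q (fun _ => rfl) x y
  have gr := map_perm_adj (R := fun v w => T.Adj v w ∧ ¬ (T.comap g₂.symm).Adj v w)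
    (fun v w => (biTree_red_adj (T := T) (I := J₃) (J := J₂) (g := g₂)).trans
      (and_congr_right' (not_congr (e v w).symm))) q (fun _ => rfl) x y
  obtain ⟨hd1, hd2⟩ := diffEnds_subset_starBlue hT (J := J₁) h₂ g₁
  obtain ⟨hg1, hg2⟩ := diffEnds_subset_starRed hT (J := J₂) h₃ g₂
  -- These facts ensure that no edge is missed because its ends lie in different parts: where `T`
  -- disagrees with a neighbouring tree, both ends are in the corresponding part, and every edge of
  -- `T` in the union lies within one part. What remains is a propositional check.
  have a1 := fun h1 h2 => mem_and_mem_of_diffEnds_subset hd1 (v := x) (w := y) h1 h2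
  have a2 := fun h1 h2 => mem_and_mem_of_diffEnds_subset hd2 (v := x) (w := y) h1 h2
  have a3 := fun h1 h2 => mem_and_mem_of_diffEnds_subset hg1 (v := x) (w := y) h1 h2
  have a4 := fun h1 h2 => mem_and_mem_of_diffEnds_subset hg2 (v := x) (w := y) h1 h2
  have a5 := fun h : T.Adj x y => adj_mem_or_mem hT.connected (pathConvex_starBlue hT h₂ g₁)
    (pathConvex_starRed hT h₃ g₂) (h₂.mono subset_starBlue_inter_starRed) h x.2 y.2
  rw [starRed] at a3 a4 a5
  clear hd1 hd2 hg1 hg2 e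
  refine ⟨(or_congr (or_congr (and_congr db (not_congr gr)) (and_congr gb (not_congr dl)))
      (and_congr dr gl)).trans ?_,
    (or_congr (and_congr dl (not_congr gr)) (and_congr gl (not_congr dr))).trans ?_,
    (or_congr (and_congr dr (not_congr gl)) (and_congr gr (not_congr dl))).trans ?_⟩ <;>
  · clear db dl dr gb gl gr
    generalize T.Adj (x : V) y = t at *
    generalize (T.comap g₁).Adj (x : V) y = t₁ at *
    generalize (T.comap g₂.symm).Adj (x : V) y = t₂ at *
    generalize ((x : V) ∈ starBlue T J₂ J₁ g₁) = xd at *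
    generalize ((y : V) ∈ starBlue T J₂ J₁ g₁) = yd at *
    generalize ((x : V) ∈ g₂ '' starBlue T J₃ J₂ g₂) = xg at *
    generalize ((y : V) ∈ g₂ '' starBlue T J₃ J₂ g₂) = yg at *
    grind

end Product

/-! ### Invariance of superposition and pruning under equivalence; gluing. -/

namespace MarkedGraph

variable {I J K : Set V}

theorem Equivalent.trans {Γ Γ' Γ'' : MarkedGraph I J} (h : Γ.Equivalent Γ')
    (h' : Γ'.Equivalent Γ'') : Γ.Equivalent Γ'' := by
  obtain ⟨e, h1, h2, h3, h4, h5⟩ := h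
  obtain ⟨e', h1', h2', h3', h4', h5'⟩ := h'
  refine ⟨e.trans e', fun v w => (h1 v w).trans (h1' _ _), fun v w => (h2 v w).trans (h2' _ _),
    fun v w => (h3 v w).trans (h3' _ _), fun a => ?_, fun b => ?_⟩
  · rw [Equiv.trans_apply, h4, h4']
  · rw [Equiv.trans_apply, h5, h5']

theorem Equivalent.prune {Γ Γ' : MarkedGraph I J} (h : Γ.Equivalent Γ') :
    Γ.prune.Equivalent Γ'.prune := by
  obtain ⟨e, h1, h2, h3, h4, h5⟩ := h
  have htot : ∀ v w, Γ.total.Adj v w ↔ Γ'.total.Adj (e v) (e w) := fun v w =>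
    or_congr (or_congr (h1 v w) (h2 v w)) (h3 v w)
  have hm : ∀ v, v ∈ Γ.marked ↔ e v ∈ Γ'.marked := by
    intro v
    refine or_congr (exists_congr fun a => ?_) (exists_congr fun b => ?_)
    · rw [← h4, e.apply_eq_iff_eq]
    · rw [← h5, e.apply_eq_iff_eq]
  have hstep : ∀ S S', (∀ v, v ∈ S ↔ e v ∈ S') →
      ∀ v, v ∈ Γ.pruneStep S ↔ e v ∈ Γ'.pruneStep S' := by
    intro S S' hS v
    refine and_congr (hS v) (not_congr (and_congr (not_congr (hm v)) ?_))
    refine e.exists_congr fun w => and_congr (hS w) (and_congr (h1 v w) ?_)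
    exact e.forall_congr fun {u} => imp_congr (hS u) (imp_congr (htot v u)
      e.apply_eq_iff_eq.symm)
  have hcore : ∀ v, v ∈ Γ.core ↔ e v ∈ Γ'.core := by
    intro v
    rw [core, core, Set.mem_iInter, Set.mem_iInter]
    refine forall_congr' fun n => ?_
    induction n generalizing v with
    | zero => exact Iff.rfl
    | succ n ih =>
      rw [Function.iterate_succ_apply', Function.iterate_succ_apply']
      exact hstep _ _ ih v
  exact ⟨e.subtypeEquiv hcore, fun v w => h1 v.1 w.1, fun v w => h2 v.1 w.1,
    fun v w => h3 v.1 w.1, fun a => Subtype.ext (h4 a), fun b => Subtype.ext (h5 b)⟩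

theorem map_comp_equiv_adj {A X X' : Type*} (H : SimpleGraph A) (p : A → X) (φ : X ≃ X')
    (x y : X) : (H.map p).Adj x y ↔ (H.map (φ ∘ p)).Adj (φ x) (φ y) := by
  simp only [SimpleGraph.map_adj', Function.comp_apply, φ.apply_eq_iff_eq, ne_eq]

theorem overlay_equivalent (Δ : MarkedGraph J K) (Γ : MarkedGraph I J) {X X' : Type u}
    {p : Δ.X → X} {q : Γ.X → X} {p' : Δ.X → X'} {q' : Γ.X → X'} (φ : X ≃ X')
    (hp' : ∀ v, φ (p v) = p' v) (hq' : ∀ w, φ (q w) = q' w) :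
    (overlay Δ Γ p q).Equivalent (overlay Δ Γ p' q') := by
  obtain rfl : φ ∘ p = p' := funext hp'
  obtain rfl : φ ∘ q = q' := funext hq'
  have hp := fun (H : SimpleGraph Δ.X) (x y : X) => map_comp_equiv_adj H p φ x y
  have hq := fun (H : SimpleGraph Γ.X) (x y : X) => map_comp_equiv_adj H q φ x y
  refine ⟨φ, fun v w => ?_, fun v w => ?_, fun v w => ?_, fun _ => rfl, fun _ => rfl⟩
  · exact or_congr (or_congr (and_congr (hp _ v w) (not_congr (hq _ v w)))
      (and_congr (hq _ v w) (not_congr (hp _ v w)))) (and_congr (hp _ v w) (hq _ v w))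
  · exact or_congr (and_congr (hp _ v w) (not_congr (hq _ v w)))
      (and_congr (hq _ v w) (not_congr (hp _ v w)))
  · exact or_congr (and_congr (hp _ v w) (not_congr (hq _ v w)))
      (and_congr (hq _ v w) (not_congr (hp _ v w)))

/-- Gluing along `J` is the same as taking the union in an ambient set, when the two parts
intersect exactly along `J`. -/
theorem exists_equiv_glue (Δ : MarkedGraph J K) (Γ : MarkedGraph I J) {X : Type u}
    (p : Δ.X → X) (q : Γ.X → X) (hp : Function.Injective p) (hq : Function.Injective q)
    (hcov : ∀ x, (∃ v, p v = x) ∨ ∃ w, q w = x)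
    (hpq : ∀ v w, p v = q w ↔ ∃ a : J, v = Δ.ι a ∧ w = Γ.j a) :
    ∃ φ : X ≃ Glue Δ Γ, (∀ v, φ (p v) = Quot.mk _ (Sum.inl v)) ∧
      ∀ w, φ (q w) = Quot.mk _ (Sum.inr w) := by
  let ψ : Glue Δ Γ → X := Quot.lift (Sum.elim p q) (by
    rintro _ _ ⟨a, rfl, rfl⟩
    exact (hpq _ _).2 ⟨a, rfl, rfl⟩)
  have hglue : ∀ v w, p v = q w →
      (Quot.mk _ (Sum.inl v) : Glue Δ Γ) = Quot.mk _ (Sum.inr w) := by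
    intro v w h
    obtain ⟨a, rfl, rfl⟩ := (hpq v w).1 h
    exact Quot.sound ⟨a, rfl, rfl⟩
  have hψ : Function.Bijective ψ := by
    constructor
    · rintro ⟨v | w⟩ ⟨v' | w'⟩ h
      · exact congrArg (fun z => Quot.mk _ (Sum.inl z)) (hp h)
      · exact hglue v w' h
      · exact (hglue v' w h.symm).symm
      · exact congrArg (fun z => Quot.mk _ (Sum.inr z)) (hq h)
    · intro x
      rcases hcov x with ⟨v, rfl⟩ | ⟨w, rfl⟩
      exacts [⟨Quot.mk _ (Sum.inl v), rfl⟩, ⟨Quot.mk _ (Sum.inr w), rfl⟩]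
  refine ⟨(Equiv.ofBijective ψ hψ).symm, fun v => ?_, fun w => ?_⟩
  · exact (Equiv.ofBijective ψ hψ).symm_apply_apply (Quot.mk _ (Sum.inl v))
  · exact (Equiv.ofBijective ψ hψ).symm_apply_apply (Quot.mk _ (Sum.inr w))

end MarkedGraph

/-! ### The bi-tree of a product. -/

section Product

variable {T : SimpleGraph V} {J₁ J₂ J₃ : Set V} {g₁ g₂ : Equiv.Perm V}

theorem starBlue_finite (hT : T.IsTree) {I J : Set V} (hI : I.Nonempty) (hIf : I.Finite)
    (hJf : J.Finite) {g : Equiv.Perm V} (hg : IsSpheromorphism T g) :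
    (starBlue T I J g).Finite := by
  rw [starBlue_eq_hull hT hI]
  exact hull_finite hT.connected (pinned_finite hIf hJf hg)
    (hI.mono fun x hx => Or.inl (Or.inr hx))

theorem thetaOverlay_black_sup_blue (hT : T.IsTree) (h₂ : J₂.Nonempty) (h₃ : J₃.Nonempty) :
    (thetaOverlay T J₁ J₂ J₃ g₁ g₂).black ⊔ (thetaOverlay T J₁ J₂ J₃ g₁ g₂).blue =
      (T.comap g₂.symm).induce (thetaVerts T J₁ J₂ J₃ g₁ g₂) := by
  ext x y
  obtain ⟨hb, hl, -⟩ := thetaOverlay_adj hT h₂ h₃ x y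
  refine (or_congr hb hl).trans ?_
  rw [← and_or_left]
  exact and_iff_left (em _)

theorem thetaOverlay_black_sup_red (hT : T.IsTree) (h₂ : J₂.Nonempty) (h₃ : J₃.Nonempty) :
    (thetaOverlay T J₁ J₂ J₃ g₁ g₂).black ⊔ (thetaOverlay T J₁ J₂ J₃ g₁ g₂).red =
      (T.comap g₁).induce (thetaVerts T J₁ J₂ J₃ g₁ g₂) := by
  ext x y
  obtain ⟨hb, -, hr⟩ := thetaOverlay_adj hT h₂ h₃ x y
  refine (or_congr (hb.trans and_comm) hr).trans ?_
  rw [← and_or_left]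
  exact and_iff_left (em _)

theorem isUnprunedBiTree_thetaOverlay (hT : T.IsTree) (hJ₁ : J₁.Finite) (hJ₂ : J₂.Finite)
    (hJ₃ : J₃.Finite) (h₂ : J₂.Nonempty) (h₃ : J₃.Nonempty) (hg₁ : IsSpheromorphism T g₁)
    (hg₂ : IsSpheromorphism T g₂) :
    (thetaOverlay T J₁ J₂ J₃ g₁ g₂).IsUnprunedBiTree T := by
  have hadj := thetaOverlay_adj (J₁ := J₁) (g₁ := g₁) (g₂ := g₂) hT h₂ h₃
  refine ⟨?_, ?_, ?_, ?_, ?_, ?_, ?_, ?_, ?_, ?_⟩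
  · exact ((starBlue_finite hT h₂ hJ₂ hJ₁ hg₁).union
      ((starBlue_finite hT h₃ hJ₃ hJ₂ hg₂).image g₂)).to_subtype
  · exact disjoint_iff_inf_le.2 fun v w h => ((hadj v w).2.1.1 h.2).2 ((hadj v w).1.1 h.1).2
  · exact disjoint_iff_inf_le.2 fun v w h => ((hadj v w).2.2.1 h.2).2 ((hadj v w).1.1 h.1).1
  · exact disjoint_iff_inf_le.2 fun v w h => ((hadj v w).2.2.1 h.2).2 ((hadj v w).2.1.1 h.1).1
  · rw [thetaOverlay_black_sup_blue hT h₂ h₃]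
    exact ⟨thetaVerts_connected_source hT h₂ h₃, (isTree_comap hT g₂.symm).isAcyclic.induce _⟩
  · rw [thetaOverlay_black_sup_red hT h₂ h₃]
    exact ⟨thetaVerts_connected_target hT h₂ h₃, (isTree_comap hT g₁).isAcyclic.induce _⟩
  · exact fun a b h => Subtype.ext (g₂.injective (congrArg Subtype.val h))
  · exact fun a b h => Subtype.ext (g₁.symm.injective (congrArg Subtype.val h))
  · intro a b h
    rw [thetaOverlay_black_sup_blue hT h₂ h₃]
    change T.Adj (g₂.symm (g₂ a)) (g₂.symm (g₂ b))
    simpa using h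
  · intro a b h
    rw [thetaOverlay_black_sup_red hT h₂ h₃]
    change T.Adj (g₁ (g₁.symm a)) (g₁ (g₁.symm b))
    simpa using h

theorem pins_thetaOverlay_nonempty (h₃ : J₃.Nonempty) :
    (thetaOverlay T J₁ J₂ J₃ g₁ g₂).pins.Nonempty := by
  obtain ⟨a, ha⟩ := h₃
  exact ⟨_, Or.inl (Or.inl ⟨⟨a, ha⟩, rfl⟩)⟩

theorem image_pins_thetaOverlay (hT : T.IsTree) (h₂ : J₂.Nonempty) (h₃ : J₃.Nonempty) :
    (Subtype.val '' (thetaOverlay T J₁ J₂ J₃ g₁ g₂).pins : Set V) =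
      g₂.symm ⁻¹' pinned T J₃ J₁ (g₁ * g₂) := by
  have hadj := thetaOverlay_adj (J₁ := J₁) (g₁ := g₁) (g₂ := g₂) hT h₂ h₃
  have hP := diffEnds_subset_starRed hT (J := J₂) h₃ g₂
  have hQ := diffEnds_subset_starBlue hT (J := J₁) h₂ g₁
  -- An edge on which source and target trees disagree is one on which `T` disagrees with one of
  -- them. So no coloured edge of the product has an end outside `thetaVerts`.
  have hY : ∀ v w, (T.comap g₂.symm).Adj v w ∧ ¬ (T.comap g₁).Adj v w ∨
      (T.comap g₁).Adj v w ∧ ¬ (T.comap g₂.symm).Adj v w →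
      v ∈ thetaVerts T J₁ J₂ J₃ g₁ g₂ := by
    intro v w h
    by_cases ht : T.Adj v w
    · rcases h with h | h
      · exact Or.inl (hQ.1 ⟨w, ht, h.2⟩)
      · exact Or.inr (hP.2 ⟨w, ht, h.2⟩)
    · rcases h with h | h
      · exact Or.inr (hP.1 ⟨w, h.1, ht⟩)
      · exact Or.inl (hQ.2 ⟨w, h.1, ht⟩)
  ext x
  constructor
  · rintro ⟨x, (⟨a, rfl⟩ | ⟨b, rfl⟩) | ⟨w, hw | hw⟩, rfl⟩
    · refine Or.inl (Or.inr ?_)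
      change g₂.symm (g₂ a) ∈ J₃
      simp
    · refine Or.inr ?_
      change g₁ (g₂ (g₂.symm (g₁.symm b))) ∈ J₁
      simp
    · refine Or.inl (Or.inl (Or.inl ⟨g₂.symm w.1, ?_⟩))
      simpa using (hadj x w).2.1.1 hw
    · refine Or.inl (Or.inl (Or.inr ⟨g₂.symm w.1, ?_⟩))
      simpa using (hadj x w).2.2.1 hw
  · rintro (((⟨w, hw⟩ | ⟨w, hw⟩) | hx) | hx)
    · have h : (T.comap g₂.symm).Adj x (g₂ w) ∧ ¬ (T.comap g₁).Adj x (g₂ w) := by simpa using hw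
      have h' := (hadj ⟨x, hY _ _ (Or.inl h)⟩
        ⟨g₂ w, hY _ x (Or.inl ⟨h.1.symm, fun h' => h.2 h'.symm⟩)⟩).2.1.2 h
      exact ⟨_, Or.inr ⟨_, Or.inl h'⟩, rfl⟩
    · have h : (T.comap g₁).Adj x (g₂ w) ∧ ¬ (T.comap g₂.symm).Adj x (g₂ w) := by simpa using hw
      have h' := (hadj ⟨x, hY _ _ (Or.inr h)⟩
        ⟨g₂ w, hY _ x (Or.inr ⟨h.1.symm, fun h' => h.2 h'.symm⟩)⟩).2.2.2 h
      exact ⟨_, Or.inr ⟨_, Or.inr h'⟩, rfl⟩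
    · exact ⟨_, Or.inl (Or.inl ⟨⟨_, hx⟩, rfl⟩), g₂.apply_symm_apply x⟩
    · refine ⟨_, Or.inl (Or.inr ⟨⟨_, hx⟩, rfl⟩), ?_⟩
      change g₁.symm ((g₁ * g₂) (g₂.symm x)) = x
      simp

theorem mem_core_thetaOverlay (hT : T.IsTree) (h₂ : J₂.Nonempty) (h₃ : J₃.Nonempty)
    (hO : (thetaOverlay T J₁ J₂ J₃ g₁ g₂).IsUnprunedBiTree T)
    (y : thetaVerts T J₁ J₂ J₃ g₁ g₂) :
    y ∈ (thetaOverlay T J₁ J₂ J₃ g₁ g₂).core ↔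
      g₂.symm y ∈ starBlue T J₃ J₁ (g₁ * g₂) := by
  rw [hO.core_eq_hull (pins_thetaOverlay_nonempty h₃), thetaOverlay_black_sup_blue hT h₂ h₃]
  refine (mem_hull_induce (isTree_comap hT g₂.symm) (thetaVerts_connected_source hT h₂ h₃)
    (pins_thetaOverlay_nonempty h₃) y).trans ?_
  rw [image_pins_thetaOverlay hT h₂ h₃, hull_comap, starBlue_eq_hull hT h₃]
  rfl

theorem image_starBlue_mul_subset (hT : T.IsTree) (h₂ : J₂.Nonempty) (h₃ : J₃.Nonempty) {v : V}
    (hv : v ∈ starBlue T J₃ J₁ (g₁ * g₂)) : g₂ v ∈ thetaVerts T J₁ J₂ J₃ g₁ g₂ := by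
  have hsub : hull (T.comap g₂.symm) (g₂.symm ⁻¹' pinned T J₃ J₁ (g₁ * g₂)) ⊆
      thetaVerts T J₁ J₂ J₃ g₁ g₂ := by
    rw [← image_pins_thetaOverlay hT h₂ h₃]
    exact hull_subset (Subtype.coe_image_subset _ _) (thetaVerts_connected_source hT h₂ h₃)
  refine hsub ?_
  rw [hull_comap, ← starBlue_eq_hull hT h₃]
  simpa using hv

/-- The bi-tree of a product is obtained by pruning the superposition of the bi-trees of the
factors. -/
theorem biTree_mul_equivalent_prune (hT : T.IsTree) (h₂ : J₂.Nonempty) (h₃ : J₃.Nonempty)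
    (hO : (thetaOverlay T J₁ J₂ J₃ g₁ g₂).IsUnprunedBiTree T) :
    (biTree T J₃ J₁ (g₁ * g₂)).Equivalent (thetaOverlay T J₁ J₂ J₃ g₁ g₂).prune := by
  have hcore := mem_core_thetaOverlay hT h₂ h₃ hO
  have hadj := thetaOverlay_adj (J₁ := J₁) (g₁ := g₁) (g₂ := g₂) hT h₂ h₃
  let e : starBlue T J₃ J₁ (g₁ * g₂) ≃ (thetaOverlay T J₁ J₂ J₃ g₁ g₂).core :=
    { toFun := fun v => ⟨⟨g₂ v, image_starBlue_mul_subset hT h₂ h₃ v.2⟩,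
        (hcore _).2 (by simp)⟩
      invFun := fun y => ⟨g₂.symm y.1.1, (hcore y.1).1 y.2⟩
      left_inv := fun v => Subtype.ext (g₂.symm_apply_apply v)
      right_inv := fun y => Subtype.ext (Subtype.ext (g₂.apply_symm_apply _)) }
  refine ⟨e, fun v w => ?_, fun v w => ?_, fun v w => ?_, fun a => rfl, fun b => ?_⟩
  · refine biTree_black_adj.trans (Iff.trans ?_ (hadj (e v).1 (e w).1).1.symm)
    simp [e]
  · refine biTree_blue_adj.trans (Iff.trans ?_ (hadj (e v).1 (e w).1).2.1.symm)
    simp [e]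
  · refine biTree_red_adj.trans (Iff.trans ?_ (hadj (e v).1 (e w).1).2.2.symm)
    simp [e]
  · refine Subtype.ext (Subtype.ext ?_)
    change g₂ ((g₁ * g₂).symm b) = g₁.symm b
    exact g₂.apply_symm_apply _

/-- The hypothesis says that the two drawings share only the vertices that gluing identifies, so the
glued vertex set maps bijectively onto `thetaVerts`. -/
theorem thetaOverlay_prune_equivalent_diamond
    (h : starRed T J₃ J₂ g₂ ∩ starBlue T J₂ J₁ g₁ = J₂) :
    (thetaOverlay T J₁ J₂ J₃ g₁ g₂).prune.Equivalent
      (MarkedGraph.diamond (biTree T J₂ J₁ g₁) (biTree T J₃ J₂ g₂)) := by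
  let p : starBlue T J₂ J₁ g₁ → thetaVerts T J₁ J₂ J₃ g₁ g₂ := fun v => ⟨v, Or.inl v.2⟩
  let q : starBlue T J₃ J₂ g₂ → thetaVerts T J₁ J₂ J₃ g₁ g₂ :=
    fun v => ⟨g₂ v, Or.inr ⟨v, v.2, rfl⟩⟩
  have hpi : Function.Injective p := fun v w hvw =>
    Subtype.ext (congrArg (fun z : thetaVerts T J₁ J₂ J₃ g₁ g₂ => (z : V)) hvw)
  have hqi : Function.Injective q := fun v w hvw =>
    Subtype.ext (g₂.injective (congrArg (fun z : thetaVerts T J₁ J₂ J₃ g₁ g₂ => (z : V)) hvw))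
  have hcov : ∀ x, (∃ v, p v = x) ∨ ∃ w, q w = x := by
    rintro ⟨x, hx | ⟨v, hv, rfl⟩⟩
    exacts [Or.inl ⟨⟨x, hx⟩, rfl⟩, Or.inr ⟨⟨v, hv⟩, rfl⟩]
  have hpq : ∀ v w, p v = q w ↔
      ∃ a : J₂, v = (biTree T J₂ J₁ g₁).ι a ∧ w = (biTree T J₃ J₂ g₂).j a := by
    intro v w
    constructor
    · intro hvw
      have hvw : (v : V) = g₂ w := congrArg Subtype.val hvw
      have hv : (v : V) ∈ starRed T J₃ J₂ g₂ ∩ starBlue T J₂ J₁ g₁ := ⟨⟨w, w.2, hvw.symm⟩, v.2⟩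
      rw [h] at hv
      exact ⟨⟨v, hv⟩, rfl, Subtype.ext (g₂.symm_apply_eq.2 hvw).symm⟩
    · rintro ⟨a, rfl, rfl⟩
      exact Subtype.ext (g₂.apply_symm_apply _).symm
  obtain ⟨φ, hp, hq⟩ := MarkedGraph.exists_equiv_glue (biTree T J₂ J₁ g₁) (biTree T J₃ J₂ g₂) p q
    hpi hqi hcov hpq
  exact (MarkedGraph.overlay_equivalent _ _ φ hp hq).prune

end Product

end Hier

theorem lemma4p4 {V : Type*} (T : SimpleGraph V) (hT : Hier.IsOmegaTree T)
    (J₁ J₂ J₃ : Set V) (hJ₁ : Hier.IsFiniteSubtree T J₁) (hJ₂ : Hier.IsFiniteSubtree T J₂)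
    (hJ₃ : Hier.IsFiniteSubtree T J₃) (g₁ g₂ : Equiv.Perm V)
    (hg₁ : Hier.IsSpheromorphism T g₁) (hg₂ : Hier.IsSpheromorphism T g₂) :
    (Hier.theta T J₁ J₂ J₃ g₁ g₂).IsBiTree T ∧
    (Hier.biTree T J₃ J₁ (g₁ * g₂)).Equivalent (Hier.theta T J₁ J₂ J₃ g₁ g₂) ∧
    (Hier.starRed T J₃ J₂ g₂ ∩ Hier.starBlue T J₂ J₁ g₁ = J₂ →
      (Hier.biTree T J₃ J₁ (g₁ * g₂)).Equivalent
        (Hier.MarkedGraph.diamond (Hier.biTree T J₂ J₁ g₁) (Hier.biTree T J₃ J₂ g₂))) := by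
  have h₂ : J₂.Nonempty := Set.nonempty_coe_sort.1 hJ₂.2.nonempty
  have h₃ : J₃.Nonempty := Set.nonempty_coe_sort.1 hJ₃.2.nonempty
  have hO := Hier.isUnprunedBiTree_thetaOverlay hT.isTree hJ₁.1 hJ₂.1 hJ₃.1 h₂ h₃ hg₁ hg₂
  have heq := Hier.biTree_mul_equivalent_prune hT.isTree h₂ h₃ hO
  -- `theta` is by definition the pruning of `thetaOverlay`.
  exact ⟨hO.isBiTree_prune (Hier.pins_thetaOverlay_nonempty h₃), heq, fun h =>
    heq.trans (Hier.thetaOverlay_prune_equivalent_diamond h)⟩
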